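/- Let $E=E^{n+1}$ be a finite-dimensional complex Banach space with a basis $e_0,\dots,e_n$, which identifies $E$ with the space of complex-valued functions on $\{0,1,\dots,n\}$ (and $e_0,\dots,e_n$ with the standard basis). Suppose that $E$ is an ideal space, that is, for all complex numbers $a_i,b_i$, if $|a_i|\le|b_i|$ for $i=0,\dots,n$, then $\bigl\|\sum_{i=0}^n a_ie_i\bigr\|\le\bigl\|\sum_{i=0}^n b_ie_i\bigr\|$. Let $H$ be a Hermitian operator on $E$, that is, a linear operator with $\|e^{itH}\|=1$ for all $t\in\mathbb R$, and suppose that $$(He_0,e_k)\neq0,\qquad k=1,\dots,n,$$ where $(x,e_k)$ denotes the $k$-th coordinate of $x$ in the basis $e_0,\dots,e_n$. Then $E$ is a Euclidean space, i.e. its norm is induced by a Hermitian scalar product on $E$, and for all $c_0,\dots,c_n\in\mathbb C$, $$\Bigl\|\sum_{i=0}^n c_ie_i\Bigr\|^2=\sum_{i=0}^n|c_i|^2\,\|e_i\|^2 .$$ -/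

import Mathlib

/-- `E`, regarded through the basis `e` as the space of all complex-valued functions on the finite
set `ι` (a vector is identified with its coordinate function `i ↦ e.repr x i`, and `e` with the
standard basis), is an *ideal* space: `|g| ≤ |f|` pointwise implies `‖g‖ ≤ ‖f‖`.
(The requirement that `g` belong to the space is automatic, since every function on `ι` does.) -/
def IsIdealSpace {ι E : Type*} [NormedAddCommGroup E] [NormedSpace ℂ E]
    (e : Module.Basis ι ℂ E) : Prop :=
  ∀ f g : E, (∀ i, ‖e.repr g i‖ ≤ ‖e.repr f i‖) → ‖g‖ ≤ ‖f‖

/-- A bounded operator `H` on a complex Banach space is *Hermitian* if `‖exp (i t H)‖ = 1` for all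
real `t` (operator norm). -/
def IsHermitianOperator {E : Type*} [NormedAddCommGroup E] [NormedSpace ℂ E]
    (H : E →L[ℂ] E) : Prop :=
  ∀ t : ℝ, ‖NormedSpace.exp ((Complex.I * (t : ℂ)) • H)‖ = 1

/-- The norm of `E` comes from a (positive definite, sesquilinear) scalar product on the complex
vector space `E`. -/
def IsEuclideanSpace (E : Type*) [NormedAddCommGroup E] [NormedSpace ℂ E] : Prop :=
  ∃ c : InnerProductSpace.Core ℂ E, ∀ x : E, ‖x‖ ^ 2 = (c.inner x x).re

/-! In an ideal space, diagonal sign operators are contractions, and Hermitian operators are closed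
under real combinations and under conjugation by these involutions. So signs cut `H` down to a
Hermitian `K` that only exchanges the lines of `e 0` and `e k` (`exists_exchange`). The isometries
`exp (itK)` rotate that plane in rescaled coordinates (`exists_rotation`) and fix the other basis
vectors. Since the norm sees only moduli of coordinates, a rotation merges `|c k|` into the `0`-th
coordinate as `√(|c 0|² + w |c k|²)`. Merging every `k` leaves a multiple of `e 0`, and testing on
`e k` identifies `w`. -/

open Filter Topology

/-! ### Generators of contraction groups in a Banach algebra -/

section BanachAlgebra

variable {𝔸 : Type*} [NormedRing 𝔸] [NormedAlgebra ℝ 𝔸] [CompleteSpace 𝔸]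

/-- The one-parameter group generated by `B` consists of contractions. -/
def GeneratesContractions (B : 𝔸) : Prop := ∀ t : ℝ, ‖NormedSpace.exp (t • B)‖ ≤ 1

/-- A first-order condition at `t = 0` is easy to add and conjugate, unlike exponentials of
noncommuting elements. It suffices because `exp (sB) = exp (sB/m) ^ m` is bounded by `(1 + ε|s|/m) ^
m ≤ exp (ε|s|)`, with `ε` arbitrary. -/
theorem generatesContractions_iff (B : 𝔸) :
    GeneratesContractions B ↔ ∀ ε > 0, ∀ᶠ t : ℝ in 𝓝 0, ‖1 + t • B‖ ≤ 1 + ε * |t| := by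
  have hd : ∀ ε > 0, ∀ᶠ t : ℝ in 𝓝 0, ‖NormedSpace.exp (t • B) - (1 + t • B)‖ ≤ ε * |t| := by
    intro ε hε
    have h := hasDerivAt_exp_smul_const (𝕂 := ℝ) B (0 : ℝ)
    rw [hasDerivAt_iff_isLittleO_nhds_zero] at h
    filter_upwards [h.def hε] with t ht
    simpa [sub_sub] using ht
  constructor
  · intro h ε hε
    filter_upwards [hd ε hε] with t ht
    calc ‖1 + t • B‖ = ‖NormedSpace.exp (t • B) - (NormedSpace.exp (t • B) - (1 + t • B))‖ := by
          congr 1; abel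
      _ ≤ _ := (norm_sub_le _ _).trans (add_le_add (h t) ht)
  · intro h s
    have key : ∀ ε > 0, ‖NormedSpace.exp (s • B)‖ ≤ Real.exp (ε * |s|) := by
      intro ε hε
      have h1 : ∀ᶠ t : ℝ in 𝓝 0, ‖NormedSpace.exp (t • B)‖ ≤ 1 + ε * |t| := by
        filter_upwards [hd (ε / 2) (half_pos hε), h (ε / 2) (half_pos hε)] with t h2 h3
        calc ‖NormedSpace.exp (t • B)‖
            = ‖(NormedSpace.exp (t • B) - (1 + t • B)) + (1 + t • B)‖ := by congr 1; abel
          _ ≤ _ := (norm_add_le _ _).trans (by linarith)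
      have h2 : Tendsto (fun m : ℕ => s / (m : ℝ)) atTop (𝓝 0) :=
        tendsto_const_div_atTop_nhds_zero_nat s
      obtain ⟨m, hm, hm0⟩ := ((h2.eventually h1).and (eventually_gt_atTop 0)).exists
      have hm' : (m : ℝ) ≠ 0 := by positivity
      have h3 : s • B = m • ((s / m) • B) := by
        rw [← Nat.cast_smul_eq_nsmul ℝ, smul_smul, mul_div_cancel₀ _ hm']
      let := NormedAlgebra.restrictScalars ℚ ℝ 𝔸
      rw [h3, NormedSpace.exp_nsmul m ((s / m) • B)]
      calc _ ≤ ‖NormedSpace.exp ((s / m) • B)‖ ^ m := norm_pow_le' _ hm0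
        _ ≤ (Real.exp (ε * |s / m|)) ^ m := by
          gcongr
          exact hm.trans (by linarith [Real.add_one_le_exp (ε * |s / m|)])
        _ = _ := by
          rw [← Real.exp_nat_mul, abs_div, Nat.abs_cast]
          congr 1; field_simp
    have h4 : Tendsto (fun ε : ℝ => Real.exp (ε * |s|)) (𝓝[>] 0) (𝓝 1) := by
      have : ContinuousAt (fun ε : ℝ => Real.exp (ε * |s|)) 0 := by fun_prop
      simpa [ContinuousAt] using this.tendsto.mono_left nhdsWithin_le_nhds
    exact ge_of_tendsto h4 (eventually_mem_nhdsWithin.mono fun ε hε => key ε hε)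

theorem GeneratesContractions.add {A B : 𝔸} (hA : GeneratesContractions A)
    (hB : GeneratesContractions B) : GeneratesContractions (A + B) := by
  rw [generatesContractions_iff] at *
  intro ε hε
  have h2 : Tendsto (fun t : ℝ => 2 * t) (𝓝 0) (𝓝 0) := by
    have : Continuous fun t : ℝ => 2 * t := by fun_prop
    simpa using this.tendsto 0
  filter_upwards [h2.eventually (hA (ε / 2) (half_pos hε)),
    h2.eventually (hB (ε / 2) (half_pos hε))] with t h3 h4
  -- The midpoint of the two first-order terms at time `2t`; no commutation is needed.
  have h5 : 1 + t • (A + B) = (1 / 2 : ℝ) • ((1 + (2 * t) • A) + (1 + (2 * t) • B)) := by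
    module
  rw [h5, norm_smul]
  have h6 := norm_add_le (1 + (2 * t) • A) (1 + (2 * t) • B)
  rw [abs_mul, abs_two] at h3 h4
  norm_num
  linarith

theorem GeneratesContractions.sub {A B : 𝔸} (hA : GeneratesContractions A)
    (hB : GeneratesContractions B) : GeneratesContractions (A - B) := by
  have hB' : GeneratesContractions (-B) := fun t => by simpa using hB (-t)
  simpa [sub_eq_add_neg] using hA.add hB'

theorem GeneratesContractions.conj {B D : 𝔸} (h : GeneratesContractions B) (hD : ‖D‖ ≤ 1)
    (hDD : D * D = 1) : GeneratesContractions (D * B * D) := by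
  rw [generatesContractions_iff] at *
  intro ε hε
  filter_upwards [h ε hε] with t ht
  have : 1 + t • (D * B * D) = D * (1 + t • B) * D := by
    simp [mul_add, add_mul, hDD]
  rw [this]
  calc _ ≤ ‖D‖ * ‖1 + t • B‖ * ‖D‖ :=
        (norm_mul_le _ _).trans (by gcongr; exact norm_mul_le _ _)
    _ ≤ 1 * ‖1 + t • B‖ * 1 := by gcongr
    _ ≤ _ := by simpa using ht

end BanachAlgebra

/-! ### Exponentials of operators on vectors and planes -/

section Operators

variable {E : Type*} [NormedAddCommGroup E] [NormedSpace ℂ E] [CompleteSpace E]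

theorem hasSum_exp_apply (A : E →L[ℂ] E) (v : E) :
    HasSum (fun n : ℕ => ((n.factorial : ℂ)⁻¹) • (A ^ n) v) (NormedSpace.exp A v) := by
  have h := NormedSpace.exp_series_hasSum_exp' (𝕂 := ℂ) A
  simpa using h.mapL (ContinuousLinearMap.apply ℂ E v)

theorem exp_apply_of_eigenvector {A : E →L[ℂ] E} {v : E} {μ : ℂ} (h : A v = μ • v) :
    NormedSpace.exp A v = Complex.exp μ • v := by
  have hn : ∀ n : ℕ, (A ^ n) v = μ ^ n • v := by
    intro n
    induction n with
    | zero => simp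
    | succ n ih =>
      rw [pow_succ, mul_apply_eq_comp, h, map_smul, ih, smul_smul, pow_succ']
  have h1 := hasSum_exp_apply A v
  have h2 := (NormedSpace.exp_series_hasSum_exp' (𝕂 := ℂ) μ).smul_const v
  rw [← Complex.exp_eq_exp_ℂ] at h2
  refine h1.unique ?_
  simpa [hn, smul_smul] using h2

theorem exp_apply_of_apply_apply_eq_zero {A : E →L[ℂ] E} {v : E} (h : A (A v) = 0) :
    NormedSpace.exp A v = v + A v := by
  have hn : ∀ n ∉ Finset.range 2, ((n.factorial : ℂ)⁻¹) • (A ^ n) v = 0 := by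
    intro n hn
    obtain ⟨m, rfl⟩ : ∃ m, n = m + 2 := ⟨n - 2, by simp at hn; omega⟩
    rw [pow_add, mul_apply_eq_comp, pow_two, mul_apply_eq_comp, h,
      map_zero, smul_zero]
  have := hasSum_sum_of_ne_finset_zero (L := .unconditional ℕ) hn
  simpa [Finset.sum_range_succ] using (hasSum_exp_apply A v).unique this

theorem GeneratesContractions.norm_exp_apply {B : E →L[ℂ] E} (h : GeneratesContractions B)
    (t : ℝ) (x : E) : ‖NormedSpace.exp (t • B) x‖ = ‖x‖ := by
  have hle : ∀ (s : ℝ) (y : E), ‖NormedSpace.exp (s • B) y‖ ≤ ‖y‖ := fun s y =>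
    ((NormedSpace.exp (s • B)).le_opNorm y).trans
      (mul_le_of_le_one_left (norm_nonneg y) (h s))
  refine le_antisymm (hle t x) ?_
  let := NormedAlgebra.restrictScalars ℚ ℝ (E →L[ℂ] E)
  have h1 : NormedSpace.exp ((-t) • B) * NormedSpace.exp (t • B) = 1 := by
    rw [← NormedSpace.exp_add_of_commute]
    · simp
    · exact ((Commute.refl B).smul_left _).smul_right _
  calc ‖x‖ = ‖NormedSpace.exp ((-t) • B) (NormedSpace.exp (t • B) x)‖ := by
        rw [← mul_apply_eq_comp, h1, one_apply_eq_self]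
    _ ≤ _ := hle _ _

/-- If `K` exchanges the lines spanned by `u` and `v` and is Hermitian, then `exp (i t K)` acts on
their plane by rotations, in suitably rescaled coordinates. -/
theorem exists_rotation {K : E →L[ℂ] E} (hK : GeneratesContractions (Complex.I • K)) {u v : E}
    {a b : ℂ} (hu : K u = a • v) (hv : K v = b • u) (ha : a ≠ 0)
    (huv : LinearIndependent ℂ ![u, v]) :
    ∃ r : ℝ, r ≠ 0 ∧ ∀ t : ℝ, NormedSpace.exp (t • (Complex.I • K)) u =
      (Real.cos (t * r) : ℂ) • u + (Complex.I * (a / r) * Real.sin (t * r)) • v := by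
  have hv0 : v ≠ 0 := huv.ne_zero 1
  -- On the plane `K² = ab`, so the eigenvalues of `K` there are `±r`.
  obtain ⟨r, hr⟩ := IsAlgClosed.exists_pow_nat_eq (a * b) (n := 2) two_pos
  have hr0 : r ≠ 0 := by
    -- If `r = 0`, then `K² u = 0` and the orbit `u + itKu` grows linearly, though its norm is
    -- constant.
    rintro rfl
    have hb : b = 0 := by simpa [ha] using hr.symm
    have h1 : ∀ t : ℝ, |t| * ‖a • v‖ ≤ 2 * ‖u‖ := by
      intro t
      have h2 : NormedSpace.exp (t • (Complex.I • K)) u = u + (t • (Complex.I • K)) u := by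
        apply exp_apply_of_apply_apply_eq_zero
        simp [hu, hv, hb]
      have h3 := hK.norm_exp_apply t u
      rw [h2] at h3
      have h4 := norm_sub_le (u + (t • (Complex.I • K)) u) u
      rw [h3, add_sub_cancel_left] at h4
      have h5 : ‖(t • (Complex.I • K)) u‖ = |t| * ‖a • v‖ := by
        simp [norm_smul, hu]
      linarith
    have hpos : 0 < ‖a • v‖ := by simp [ha, hv0]
    have h2 := h1 ((2 * ‖u‖ + 1) / ‖a • v‖)
    rw [abs_of_nonneg (by positivity), div_mul_cancel₀ _ hpos.ne'] at h2
    linarith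
  have heig : ∀ s : ℂ, s ^ 2 = a * b → ∀ t : ℝ,
      NormedSpace.exp (t • (Complex.I • K)) (s • u + a • v)
        = Complex.exp (t * s * Complex.I) • (s • u + a • v) := by
    intro s hs t
    apply exp_apply_of_eigenvector
    have : K (s • u + a • v) = s • (s • u + a • v) := by
      rw [map_add, map_smul, map_smul, hu, hv, smul_add, smul_smul, smul_smul, smul_smul, ← hs,
        ← pow_two, add_comm]
    rw [smul_apply, smul_apply, this,
      ← Complex.coe_smul, smul_smul, smul_smul]
    congr 1; ring
  -- Isometry on the eigenvector forces `|exp (ir)| = 1`.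
  have him : r.im = 0 := by
    have h1 := hK.norm_exp_apply 1 (r • u + a • v)
    rw [heig r hr 1, norm_smul] at h1
    have hne : r • u + a • v ≠ 0 := fun h0 =>
      hr0 (LinearIndependent.pair_iff.mp huv r a h0).1
    have h2 : ‖Complex.exp ((1 : ℝ) * r * Complex.I)‖ = 1 := by
      have := norm_pos_iff.mpr hne
      exact mul_right_cancel₀ this.ne' (by rw [h1, one_mul])
    simpa [Complex.norm_exp] using h2
  obtain ⟨ρ, rfl⟩ : ∃ ρ : ℝ, r = ρ := ⟨r.re, Complex.ext (by simp) (by simp [him])⟩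
  refine ⟨ρ, by exact_mod_cast hr0, fun t => ?_⟩
  have h1 := heig ρ hr t
  have h2 := heig (-ρ) (by rw [neg_sq, hr]) t
  have h3 : u = (2 * (ρ : ℂ))⁻¹ • (((ρ : ℂ) • u + a • v) - ((-ρ : ℂ) • u + a • v)) := by
    rw [add_sub_add_right_eq_sub, ← sub_smul, smul_smul, sub_neg_eq_add, ← two_mul,
      inv_mul_cancel₀ (by simpa using hr0), one_smul]
  conv_lhs => rw [h3]
  rw [map_smul, map_sub, h1, h2]
  rw [Complex.ofReal_cos, Complex.ofReal_sin, Complex.ofReal_mul, mul_neg, Complex.cos,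
    Complex.sin, neg_mul]
  have hI := Complex.I_sq
  generalize Complex.exp (t * ρ * Complex.I) = p, Complex.exp (-(t * ρ * Complex.I)) = q
  match_scalars
  · field_simp
    ring
  · field_simp
    linear_combination (p - q) * hI

end Operators

/-! ### Ideal spaces: isolating a plane and merging coordinates -/

section IdealSpace

variable {ι E : Type*} [NormedAddCommGroup E] [NormedSpace ℂ E]

theorem IsIdealSpace.norm_eq {e : Module.Basis ι ℂ E} (hE : IsIdealSpace e) {f g : E}
    (h : ∀ i, ‖e.repr f i‖ = ‖e.repr g i‖) : ‖f‖ = ‖g‖ :=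
  le_antisymm (hE g f fun i => (h i).le) (hE f g fun i => (h i).ge)

variable [Fintype ι]

/-- The operator that is diagonal in the basis `e`, with diagonal `s`. -/
noncomputable def diagonalOperator [FiniteDimensional ℂ E] (e : Module.Basis ι ℂ E) (s : ι → ℂ) :
    E →L[ℂ] E :=
  LinearMap.toContinuousLinearMap (e.constr ℂ fun i => s i • e i)

@[simp]
theorem diagonalOperator_basis [FiniteDimensional ℂ E] (e : Module.Basis ι ℂ E) (s : ι → ℂ)
    (i : ι) : diagonalOperator e s (e i) = s i • e i := by
  exact e.constr_basis ℂ _ i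

@[simp]
theorem repr_diagonalOperator [FiniteDimensional ℂ E] (e : Module.Basis ι ℂ E) (s : ι → ℂ)
    (x : E) (i : ι) : e.repr (diagonalOperator e s x) i = s i * e.repr x i := by
  classical
  conv_lhs => rw [← e.sum_repr x]
  simp only [map_sum, map_smul, diagonalOperator_basis, Module.Basis.repr_self,
    Finsupp.finsetSum_apply, Finsupp.smul_apply]
  simp [Finsupp.single_apply, mul_comm]

theorem IsIdealSpace.norm_diagonalOperator_le [FiniteDimensional ℂ E] {e : Module.Basis ι ℂ E}
    (hE : IsIdealSpace e) {s : ι → ℂ} (hs : ∀ i, ‖s i‖ ≤ 1) : ‖diagonalOperator e s‖ ≤ 1 := by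
  refine ContinuousLinearMap.opNorm_le_bound _ zero_le_one fun x => ?_
  rw [one_mul]
  refine hE _ _ fun i => ?_
  rw [repr_diagonalOperator, norm_mul]
  exact mul_le_of_le_one_left (norm_nonneg _) (hs i)

/-- The scalar product for which the basis `e` is orthogonal, each `e i` keeping its norm. -/
@[reducible]
noncomputable def weightedInnerCore (e : Module.Basis ι ℂ E) : InnerProductSpace.Core ℂ E where
  inner x y := ∑ i, ((‖e i‖ ^ 2 : ℝ) : ℂ) * (starRingEnd ℂ (e.repr x i) * e.repr y i)
  conj_inner_symm x y := by
    simp [map_sum, mul_comm]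
  re_inner_nonneg x := by
    rw [map_sum]
    refine Finset.sum_nonneg fun i _ => ?_
    rw [← Complex.normSq_eq_conj_mul_self, ← Complex.ofReal_mul]
    exact mul_nonneg (by positivity) (Complex.normSq_nonneg _)
  add_left x y z := by
    simp [add_mul, mul_add, Finset.sum_add_distrib]
  smul_left x y a := by
    simp only [map_smul, Finsupp.smul_apply, smul_eq_mul, map_mul, Finset.mul_sum]
    exact Finset.sum_congr rfl fun i _ => by ring
  definite x hx := by
    have h1 : ∑ i, ‖e i‖ ^ 2 * Complex.normSq (e.repr x i) = 0 := by
      have : ((∑ i, ‖e i‖ ^ 2 * Complex.normSq (e.repr x i) : ℝ) : ℂ) = 0 := by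
        rw [← hx, Complex.ofReal_sum]
        exact Finset.sum_congr rfl fun i _ => by
          rw [← Complex.normSq_eq_conj_mul_self, Complex.ofReal_mul]
      exact_mod_cast this
    rw [Finset.sum_eq_zero_iff_of_nonneg fun i _ =>
      mul_nonneg (by positivity) (Complex.normSq_nonneg _)] at h1
    apply e.repr.injective
    ext i
    have h2 := h1 i (Finset.mem_univ i)
    simpa [e.ne_zero i] using h2

theorem weightedInnerCore_self_re (e : Module.Basis ι ℂ E) (x : E) :
    ((weightedInnerCore e).inner x x).re = ∑ i, ‖e.repr x i‖ ^ 2 * ‖e i‖ ^ 2 := by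
  change (∑ i, ((‖e i‖ ^ 2 : ℝ) : ℂ) * (starRingEnd ℂ (e.repr x i) * e.repr x i)).re = _
  rw [Complex.re_sum]
  refine Finset.sum_congr rfl fun i _ => ?_
  rw [← Complex.normSq_eq_conj_mul_self, ← Complex.ofReal_mul, Complex.ofReal_re,
    Complex.normSq_eq_norm_sq, mul_comm]

variable [DecidableEq ι]

/-- The diagonal sign operators cut out of a Hermitian `H` the part that exchanges the `o`-th and
the `k`-th coordinate lines. -/
theorem IsIdealSpace.exists_exchange [FiniteDimensional ℂ E] {e : Module.Basis ι ℂ E}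
    (hE : IsIdealSpace e) {H : E →L[ℂ] E} (hH : GeneratesContractions (Complex.I • H))
    {o k : ι} (hok : o ≠ k) :
    ∃ K : E →L[ℂ] E, GeneratesContractions (Complex.I • K) ∧
      K (e o) = (4 * e.repr (H (e o)) k) • e k ∧ K (e k) = (4 * e.repr (H (e k)) o) • e o ∧
      ∀ j, j ≠ o → j ≠ k → K (e j) = 0 := by
  have := FiniteDimensional.complete ℂ E
  let s : ι → ι → ℂ := fun j i => if i = j then -1 else 1
  let D : ι → E →L[ℂ] E := fun j => diagonalOperator e (s j)
  have hD : ∀ j, ‖D j‖ ≤ 1 := fun j => hE.norm_diagonalOperator_le fun i => by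
    simp only [s]; split_ifs <;> simp
  have hDD : ∀ j, D j * D j = 1 := by
    intro j
    ext x
    apply e.repr.injective
    ext i
    simp only [D, mul_apply_eq_comp, repr_diagonalOperator, one_apply_eq_self, s]
    split_ifs <;> simp
  have hsub : ∀ (A : E →L[ℂ] E) (j : ι), GeneratesContractions (Complex.I • A) →
      GeneratesContractions (Complex.I • (A - D j * A * D j)) := by
    intro A j hA
    have := hA.sub (hA.conj (hD j) (hDD j))
    rwa [mul_smul_comm, smul_mul_assoc, ← smul_sub] at this
  -- The factor is `2` if exactly one of `i`, `l` equals `j`, and `0` otherwise. Using `j = k` and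
  -- `j = o` keeps only the two exchange entries, each times `4`.
  have hcoord : ∀ (A : E →L[ℂ] E) (j l i : ι), e.repr ((A - D j * A * D j) (e l)) i =
      (1 - s j i * s j l) * e.repr (A (e l)) i := by
    intro A j l i
    simp [D, mul_apply_eq_comp]
    ring
  refine ⟨_, hsub _ o (hsub _ k hH), ?_, ?_, fun j hjo hjk => ?_⟩
  all_goals
    apply e.repr.injective
    ext i
    rw [hcoord, hcoord]
    by_cases hio : i = o <;> by_cases hik : i = k <;>
      simp_all [s, Ne.symm] <;> grind

/-- Rotating in the plane of the `o`-th and `k`-th coordinates moves the `k`-th coordinate into the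
`o`-th one. -/
theorem IsIdealSpace.exists_norm_eq_update [FiniteDimensional ℂ E] {e : Module.Basis ι ℂ E}
    (hE : IsIdealSpace e) {H : E →L[ℂ] E} (hH : GeneratesContractions (Complex.I • H))
    {o k : ι} (hok : o ≠ k) (hne : e.repr (H (e o)) k ≠ 0) :
    ∃ w : ℝ, 0 ≤ w ∧ ∀ c : ι → ℂ, ‖e.equivFun.symm c‖ = ‖e.equivFun.symm (Function.update
      (Function.update c k 0) o (√(‖c o‖ ^ 2 + w * ‖c k‖ ^ 2) : ℝ))‖ := by
  have := FiniteDimensional.complete ℂ E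
  obtain ⟨K, hK, hKo, hKk, hKj⟩ := hE.exists_exchange hH hok
  set a := 4 * e.repr (H (e o)) k with ha
  have ha0 : a ≠ 0 := by simpa [ha] using hne
  have hli : LinearIndependent ℂ ![e o, e k] := by
    have := e.linearIndependent.comp ![o, k] (by
      intro i j h
      fin_cases i <;> fin_cases j <;> simp_all [Ne.symm])
    convert this using 1
    ext i
    fin_cases i <;> rfl
  obtain ⟨r, hr0, hr⟩ := exists_rotation hK hKo hKk ha0 hli
  have har : 0 < ‖a / r‖ := by simp [ha0, hr0]
  refine ⟨(‖a / r‖⁻¹) ^ 2, by positivity, fun c => ?_⟩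
  -- `‖z‖` is the merged coordinate, and rotating by `arg z` splits it back into the moduli of `c o`
  -- and `c k`.
  set z : ℂ := ⟨‖c o‖, ‖a / r‖⁻¹ * ‖c k‖⟩ with hz
  have hzn : √(‖c o‖ ^ 2 + (‖a / r‖⁻¹) ^ 2 * ‖c k‖ ^ 2) = ‖z‖ := by
    rw [Complex.norm_eq_sqrt_sq_add_sq z, hz, mul_pow]
  rw [hzn]
  set y : E := e.equivFun.symm (Function.update (Function.update c k 0) o 0) with hy
  have hyr : ∀ i, e.repr y i = Function.update (Function.update c k 0) o 0 i := fun i => by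
    rw [← e.equivFun_apply, hy, LinearEquiv.apply_symm_apply]
  have hKy : K y = 0 := by
    rw [hy, e.equivFun_symm_apply, map_sum]
    refine Finset.sum_eq_zero fun j _ => ?_
    rw [map_smul]
    by_cases hjo : j = o
    · simp [hjo]
    by_cases hjk : j = k
    · simp [hjk, hok.symm]
    · rw [hKj j hjo hjk, smul_zero]
  have hx : e.equivFun.symm (Function.update (Function.update c k 0) o ((‖z‖ : ℝ) : ℂ))
      = ((‖z‖ : ℝ) : ℂ) • e o + y := by
    rw [LinearEquiv.symm_apply_eq]
    ext i
    rw [e.equivFun_apply, map_add, map_smul, Finsupp.add_apply, Finsupp.smul_apply, hyr,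
      Module.Basis.repr_self]
    by_cases hio : i = o
    · simp [hio]
    · simp [hio]
  have hexpy : NormedSpace.exp ((Complex.arg z / r) • (Complex.I • K)) y = y := by
    have : ((Complex.arg z / r) • (Complex.I • K)) y = (0 : ℂ) • y := by simp [hKy]
    simpa using exp_apply_of_eigenvector this
  rw [hx, ← hK.norm_exp_apply (Complex.arg z / r) (((‖z‖ : ℝ) : ℂ) • e o + y), map_add, map_smul,
    hexpy, hr, div_mul_cancel₀ _ hr0]
  refine hE.norm_eq fun i => ?_
  have h0 : e.repr (e.equivFun.symm c) i = c i := by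
    rw [← e.equivFun_apply, LinearEquiv.apply_symm_apply]
  rw [h0]
  have hcos := Complex.norm_mul_cos_arg z
  have hsin := Complex.norm_mul_sin_arg z
  simp only [map_add, map_smul, Finsupp.add_apply,
      Finsupp.smul_apply, hyr, Module.Basis.repr_self, Finsupp.single_apply]
  by_cases hio : i = o
  · subst hio
    have : ‖((‖z‖ : ℝ) : ℂ) * (Real.cos z.arg : ℂ)‖ = ‖c i‖ := by
      rw [← Complex.ofReal_mul, hcos, hz, Complex.norm_real, norm_norm]
    simpa [hok.symm] using this.symm
  by_cases hik : i = k
  · subst hik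
    have : ‖((‖z‖ : ℝ) : ℂ) * (Complex.I * (a / r) * (Real.sin z.arg : ℂ))‖ = ‖c i‖ := by
      rw [mul_left_comm, ← Complex.ofReal_mul, hsin, norm_mul, norm_mul, Complex.norm_I, hz,
        Complex.norm_real, Real.norm_of_nonneg (by positivity)]
      field_simp
    simpa [hok, hio, Ne.symm hio] using this.symm
  · simp [hio, hik, Ne.symm hio, Ne.symm hik]

theorem IsIdealSpace.exists_norm_eq_sqrt [FiniteDimensional ℂ E] {e : Module.Basis ι ℂ E}
    (hE : IsIdealSpace e) {H : E →L[ℂ] E} (hH : GeneratesContractions (Complex.I • H)) {o : ι}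
    (hne : ∀ k, k ≠ o → e.repr (H (e o)) k ≠ 0) (S : Finset ι) (hS : o ∉ S) :
    ∃ w : ι → ℝ, (∀ i, 0 ≤ w i) ∧ ∀ c : ι → ℂ, ‖e.equivFun.symm c‖ =
      ‖e.equivFun.symm fun i => if i = o then ((√(‖c o‖ ^ 2 + ∑ j ∈ S, w j * ‖c j‖ ^ 2) : ℝ) : ℂ)
        else if i ∈ S then 0 else c i‖ := by
  have hex : ∀ k, ∃ w : ℝ, 0 ≤ w ∧ (k ≠ o → ∀ c : ι → ℂ, ‖e.equivFun.symm c‖ =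
      ‖e.equivFun.symm (Function.update
      (Function.update c k 0) o (√(‖c o‖ ^ 2 + w * ‖c k‖ ^ 2) : ℝ))‖) := by
    intro k
    by_cases hk : k = o
    · exact ⟨0, le_rfl, fun h => absurd hk h⟩
    · obtain ⟨w, hw, h⟩ := hE.exists_norm_eq_update hH (Ne.symm hk) (hne k hk)
      exact ⟨w, hw, fun _ => h⟩
  choose w hw hstep using hex
  refine ⟨w, hw, ?_⟩
  induction S using Finset.induction_on with
  | empty =>
    intro c
    refine hE.norm_eq fun i => ?_
    rw [← e.equivFun_apply, ← e.equivFun_apply, LinearEquiv.apply_symm_apply,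
      LinearEquiv.apply_symm_apply]
    by_cases hio : i = o <;> simp [hio]
  | insert k S hk ih =>
    have hko : k ≠ o := fun h => hS (by simp [h])
    intro c
    rw [ih (fun h => hS (Finset.mem_insert_of_mem h)) c, hstep k hko]
    congr 2
    have hnn : 0 ≤ ‖c o‖ ^ 2 + ∑ j ∈ S, w j * ‖c j‖ ^ 2 :=
      add_nonneg (by positivity) (Finset.sum_nonneg fun j _ => mul_nonneg (hw j) (by positivity))
    ext i
    by_cases hio : i = o
    · subst hio
      simp only [Function.update_self, if_true, hko, hk, if_false, Complex.norm_real,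
        Finset.sum_insert hk, Real.norm_of_nonneg (Real.sqrt_nonneg _), Real.sq_sqrt hnn]
      congr 2
      ring
    · by_cases hik : i = k
      · simp [hik, hko]
      · simp [hio, hik]

theorem IsIdealSpace.norm_sq_eq_sum [FiniteDimensional ℂ E] {e : Module.Basis ι ℂ E}
    (hE : IsIdealSpace e) {H : E →L[ℂ] E} (hH : GeneratesContractions (Complex.I • H)) {o : ι}
    (hne : ∀ k, k ≠ o → e.repr (H (e o)) k ≠ 0) (c : ι → ℂ) :
    ‖∑ i, c i • e i‖ ^ 2 = ∑ i, ‖c i‖ ^ 2 * ‖e i‖ ^ 2 := by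
  obtain ⟨w, hw, h⟩ := hE.exists_norm_eq_sqrt hH hne (Finset.univ.erase o) (by simp)
  have h1 : ∀ c : ι → ℂ, ‖∑ i, c i • e i‖ ^ 2 =
      (‖c o‖ ^ 2 + ∑ j ∈ Finset.univ.erase o, w j * ‖c j‖ ^ 2) * ‖e o‖ ^ 2 := by
    intro c
    have hnn : 0 ≤ ‖c o‖ ^ 2 + ∑ j ∈ Finset.univ.erase o, w j * ‖c j‖ ^ 2 :=
      add_nonneg (by positivity) (Finset.sum_nonneg fun j _ => mul_nonneg (hw j) (by positivity))
    rw [← e.equivFun_symm_apply, h, e.equivFun_symm_apply, Finset.sum_eq_single o]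
    · rw [if_pos rfl, norm_smul, mul_pow, Complex.norm_real,
        Real.norm_of_nonneg (Real.sqrt_nonneg _), Real.sq_sqrt hnn]
    · intro j _ hj
      simp [hj]
    · simp
  -- Evaluating the merged formula at `e k` determines the weight.
  have h2 : ∀ k ∈ Finset.univ.erase o, ‖e k‖ ^ 2 = w k * ‖e o‖ ^ 2 := by
    intro k hk
    have hko : o ≠ k := (Finset.ne_of_mem_erase hk).symm
    have := h1 (Pi.single k 1)
    rw [Finset.sum_eq_single_of_mem k (Finset.mem_univ k) (by
      intro j _ hj; simp [hj]), Finset.sum_eq_single_of_mem k hk (by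
      intro j _ hj; simp [hj])] at this
    simpa [hko] using this
  rw [h1, ← Finset.add_sum_erase _ _ (Finset.mem_univ o), add_mul, Finset.sum_mul]
  congr 1
  refine Finset.sum_congr rfl fun k hk => ?_
  rw [h2 k hk]
  ring

end IdealSpace

theorem lemma1 {E : Type*} [NormedAddCommGroup E] [NormedSpace ℂ E] (n : ℕ)
    (e : Module.Basis (Fin (n + 1)) ℂ E) (hE : IsIdealSpace e)
    (H : E →L[ℂ] E) (hH : IsHermitianOperator H)
    (hne : ∀ k : Fin (n + 1), k ≠ 0 → e.repr (H (e 0)) k ≠ 0) :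
    IsEuclideanSpace E ∧
      ∀ c : Fin (n + 1) → ℂ, ‖∑ i, c i • e i‖ ^ 2 = ∑ i, ‖c i‖ ^ 2 * ‖e i‖ ^ 2 := by
  have := e.finiteDimensional_of_finite
  have hG : GeneratesContractions (Complex.I • H) := fun t => by
    rw [← Complex.coe_smul, smul_smul, mul_comm]
    exact (hH t).le
  have hnorm := hE.norm_sq_eq_sum hG hne
  refine ⟨⟨weightedInnerCore e, fun x => ?_⟩, hnorm⟩
  rw [weightedInnerCore_self_re, ← hnorm, e.sum_repr]
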